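/- A chord diagram $D$ is an oriented circle with a finite set $E$ of chords whose $2|E|$ endpoints are distinct. Let $G$ be the ribbon graph associated to $D$: its only vertex-disc is a disc attached to the circle, and its edge-ribbons are the chords, thickened without twists, so that $E(G)=E$. For $A\subseteq E(G)$ let $F_A$ be the surface that consists of the vertex-discs of $G$ and the edge-ribbons in $A$, and let the partial dual $G^A$ be the ribbon graph obtained from $G$ by gluing a disc to each boundary component of $F_A$ (these are the new vertex-discs) and removing the interiors of the old vertex-discs; $E(G^A)=E(G)$. The Euler genus of a ribbon graph $H$ is $\varepsilon(H)=2c(H)-|V(H)|+|E(H)|-|F(H)|$, where $c(H)$ is the number of connected components and $|V(H)|$, $|E(H)|$, $|F(H)|$ are the numbers of vertex-discs, edge-ribbons and boundary components of $H$. The partial-dual genus polynomial of $G$ is ${}^\partial\varepsilon_G(z)=\sum_{A\subseteq E(G)}z^{\varepsilon(G^A)}$. For $A\subseteq E(G)$ let $M_A$ be the adjacency matrix over $\mathbb{Z}/2$ of the intersection graph of the chord diagram obtained from $D$ by removing all chords not in $A$ (its vertices are the chords in $A$, two of them being adjacent if and only if they intersect), and let $A^c=E(G)\setminus A$. Then $${}^\partial\varepsilon_G(z)=\sum_{A\subseteq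 E(G)}z^{\operatorname{rank}(M_A)+\operatorname{rank}(M_{A^c})}.$$ -/

import Mathlib

open scoped LaurentPolynomial

/-- The corners of the edge-ribbons with edge set `E`. The ribbon of `e : E` is the rectangle
`[0,1] × [0,1]`, whose four corners are `(e, i, j)`. It is glued to vertex-discs along the two
arcs `{i} × [0,1]` (its ends); its other two sides `[0,1] × {j}` are free. -/
abbrev RibbonCorner (E : Type*) : Type _ := E × Bool × Bool

/-- A (not necessarily orientable) ribbon graph with edge set `E`, up to homeomorphism. Away from
the arcs at which ribbons are attached, the boundary circles of the vertex-discs consist of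
segments joining two corners of ribbons; `next` sends a corner to the other end of its segment.
In addition there are `isolated` vertex-discs to which no ribbon is attached. -/
structure RibbonGraph (E : Type*) where
  next : Equiv.Perm (RibbonCorner E)
  next_next : ∀ c, next (next c) = c
  next_ne : ∀ c, next c ≠ c
  isolated : ℕ

namespace RibbonGraph

/-- Move along the free side of the ribbon, to its other end. -/
def along (E : Type*) : Equiv.Perm (RibbonCorner E) where
  toFun c := (c.1, !c.2.1, c.2.2)
  invFun c := (c.1, !c.2.1, c.2.2)
  left_inv c := by simp
  right_inv c := by simp

/-- Move along the arc at which the ribbon is glued to a vertex-disc, to its other free side. -/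
def across (E : Type*) : Equiv.Perm (RibbonCorner E) where
  toFun c := (c.1, c.2.1, !c.2.2)
  invFun c := (c.1, c.2.1, !c.2.2)
  left_inv c := by simp
  right_inv c := by simp

theorem ite_ite_swap {E : Type*} [DecidableEq E] (A : Finset E) (c : RibbonCorner E) :
    (fun c : RibbonCorner E => if c.1 ∈ A then (c.1, c.2.2, c.2.1) else c)
      (if c.1 ∈ A then (c.1, c.2.2, c.2.1) else c) = c := by
  by_cases h : c.1 ∈ A <;> simp [h]

/-- Exchange the roles of the free sides and of the glued sides for the ribbons in `A`. -/
def exchange {E : Type*} [DecidableEq E] (A : Finset E) : Equiv.Perm (RibbonCorner E) where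
  toFun c := if c.1 ∈ A then (c.1, c.2.2, c.2.1) else c
  invFun c := if c.1 ∈ A then (c.1, c.2.2, c.2.1) else c
  left_inv := ite_ite_swap A
  right_inv := ite_ite_swap A

theorem exchange_exchange {E : Type*} [DecidableEq E] (A : Finset E) (c : RibbonCorner E) :
    exchange A (exchange A c) = c :=
  ite_ite_swap A c

/-- The number of orbits of the group of permutations generated by `S`. -/
noncomputable def numOrbits {X : Type*} (S : Set (Equiv.Perm X)) : ℕ :=
  Nat.card (MulAction.orbitRel.Quotient (Subgroup.closure S) X)

variable {E : Type*}

/-- The number of vertex-discs `|V(G)|`. The boundary circle of a vertex-disc runs alternately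
through boundary segments and through arcs at which ribbons are glued. -/
noncomputable def numVertices (G : RibbonGraph E) : ℕ :=
  numOrbits {G.next, across E} + G.isolated

/-- The number of face-discs `|F(G)|`, that is, of boundary components of the surface `G`. These
run alternately through boundary segments of vertex-discs and through free sides of ribbons. -/
noncomputable def numFaces (G : RibbonGraph E) : ℕ :=
  numOrbits {G.next, along E} + G.isolated

/-- The number of connected components `c(G)`. -/
noncomputable def numComponents (G : RibbonGraph E) : ℕ :=
  numOrbits {G.next, across E, along E} + G.isolated

/-- The Euler genus `2 c(G) - |V(G)| + |E(G)| - |F(G)|`. -/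
noncomputable def eulerGenus [Fintype E] (G : RibbonGraph E) : ℤ :=
  2 * (G.numComponents : ℤ) - G.numVertices + Fintype.card E - G.numFaces

/-- One step along the boundary of the spanning surface `F_A`, made of all vertex-discs and of
the ribbons in `A`: follow the free side of a ribbon in `A`, and stay on the boundary of the
vertex-disc where a ribbon that is not in `A` was attached. -/
def spanningStep [DecidableEq E] (A : Finset E) : Equiv.Perm (RibbonCorner E) where
  toFun c := if c.1 ∈ A then along E c else across E c
  invFun c := if c.1 ∈ A then along E c else across E c
  left_inv c := by by_cases h : c.1 ∈ A <;> simp [h, along, across]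
  right_inv c := by by_cases h : c.1 ∈ A <;> simp [h, along, across]

/-- The number of boundary components of the spanning surface `F_A`. -/
noncomputable def numSpanningBoundary [DecidableEq E] (G : RibbonGraph E) (A : Finset E) : ℕ :=
  numOrbits {G.next, spanningStep A} + G.isolated

/-- The partial dual `G^A`. Its vertex-discs are glued to the boundary components of the spanning
surface `F_A`, and the interiors of the old vertex-discs are removed. So the segments joining
corners are unchanged, a ribbon in `A` is now glued along the two sides that were free, and a
ribbon outside `A` is glued along the same two sides as before. Since the glued sides of a ribbon
are by convention the sides `{i} × [0,1]`, the rectangles of the ribbons in `A` are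
reparametrized by exchanging the two coordinates. -/
def partialDual [DecidableEq E] (G : RibbonGraph E) (A : Finset E) : RibbonGraph E where
  next := exchange A * G.next * exchange A
  next_next c := by simp [exchange_exchange, G.next_next]
  next_ne c hc := by
    apply G.next_ne (exchange A c)
    have := congrArg (exchange A) hc
    simpa [exchange_exchange] using this
  isolated := G.isolated

theorem numOrbits_conj {X : Type*} (s : Equiv.Perm X) (S : Set (Equiv.Perm X)) :
    numOrbits ((fun g => s * g * s⁻¹) '' S) = numOrbits S := by
  have key : ∀ (s : Equiv.Perm X) (S : Set (Equiv.Perm X)) (g : Equiv.Perm X),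
      g ∈ Subgroup.closure S → s * g * s⁻¹ ∈ Subgroup.closure ((fun g => s * g * s⁻¹) '' S) := by
    intro s S g hg
    have := Subgroup.mem_map_of_mem (MulAut.conj s).toMonoidHom hg
    rw [MonoidHom.map_closure] at this
    exact this
  refine (Nat.card_congr (Quotient.congr s ?_)).symm
  intro x y
  rw [MulAction.orbitRel_apply, MulAction.orbitRel_apply, MulAction.mem_orbit_iff,
    MulAction.mem_orbit_iff]
  constructor
  · rintro ⟨⟨g, hg⟩, rfl⟩
    exact ⟨⟨_, key s S g hg⟩, by simp [Subgroup.smul_def]⟩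
  · rintro ⟨⟨g, hg⟩, h⟩
    have h2 := key s⁻¹ _ g hg
    rw [Set.image_image] at h2
    simp only [inv_inv, mul_assoc, inv_mul_cancel, mul_one, inv_mul_cancel_left,
      Set.image_id'] at h2
    refine ⟨⟨_, h2⟩, ?_⟩
    have h3 : g (s y) = s x := h
    simp [Subgroup.smul_def, h3]

/-- The vertex-discs of `G^A` correspond to the boundary components of `F_A`. -/
theorem numVertices_partialDual [DecidableEq E] (G : RibbonGraph E) (A : Finset E) :
    (G.partialDual A).numVertices = G.numSpanningBoundary A := by
  have hi : (exchange A)⁻¹ = exchange A := rfl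
  have h : exchange A * spanningStep A * (exchange A)⁻¹ = across E := by
    ext1 c
    by_cases h : c.1 ∈ A <;> simp [exchange, spanningStep, along, across, h]
  unfold numVertices numSpanningBoundary
  rw [← numOrbits_conj (exchange A) {G.next, spanningStep A}, Set.image_pair, h, hi]
  rfl

/-- The partial-dual genus polynomial: the sum of `z ^ ε(G^A)` over all sets `A` of edges. The
Euler genus is written as an integer, so the sum is formed in `ℤ[z, z⁻¹]`. -/
noncomputable def partialDualGenusPolynomial [Fintype E] [DecidableEq E] (G : RibbonGraph E) :
    ℤ[T;T⁻¹] :=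
  ∑ A : Finset E, LaurentPolynomial.T (G.partialDual A).eulerGenus

end RibbonGraph

/-- A chord diagram with set of chords `E`. The endpoints of the `n` chords are `2 n` distinct
points of an oriented circle; they are numbered `0, …, 2 n - 1` in the order in which they
are met along the circle, from a base point. The two endpoints of the chord `e` have the numbers
`endpoint (e, false)` and `endpoint (e, true)`. -/
structure ChordDiagram (E : Type*) [Fintype E] where
  endpoint : E × Bool ≃ Fin (2 * Fintype.card E)

namespace ChordDiagram

variable {E : Type*} [Fintype E]

/-- The first endpoint of a chord, seen from the base point. -/
def first (D : ChordDiagram E) (e : E) : Fin (2 * Fintype.card E) :=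
  min (D.endpoint (e, false)) (D.endpoint (e, true))

/-- The second endpoint of a chord, seen from the base point. -/
def second (D : ChordDiagram E) (e : E) : Fin (2 * Fintype.card E) :=
  max (D.endpoint (e, false)) (D.endpoint (e, true))

/-- The intersection graph: two chords are adjacent if and only if they intersect, that is, if
their endpoints alternate along the circle. -/
def intersectionGraph (D : ChordDiagram E) : SimpleGraph E where
  Adj e f :=
    (D.first e < D.first f ∧ D.first f < D.second e ∧ D.second e < D.second f) ∨
    (D.first f < D.first e ∧ D.first e < D.second f ∧ D.second f < D.second e)
  symm := ⟨fun _ _ h => h.symm⟩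
  loopless := ⟨fun _ h => by rcases h with h | h <;> exact lt_irrefl _ h.1⟩

instance (D : ChordDiagram E) : DecidableRel D.intersectionGraph.Adj := fun e f =>
  inferInstanceAs (Decidable
    ((D.first e < D.first f ∧ D.first f < D.second e ∧ D.second e < D.second f) ∨
      (D.first f < D.first e ∧ D.first e < D.second f ∧ D.second f < D.second e)))

/-- The set of endpoints of the chords in `A`. -/
def endpointsOf (D : ChordDiagram E) (A : Finset E) : Finset (Fin (2 * Fintype.card E)) :=
  (A ×ˢ Finset.univ).map D.endpoint.toEmbedding

theorem card_endpointsOf (D : ChordDiagram E) (A : Finset E) :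
    (D.endpointsOf A).card = 2 * Fintype.card A := by
  simp [endpointsOf, mul_comm]

/-- The endpoints of the chords in `A`, labelled by their chord. -/
def endpointEquiv (D : ChordDiagram E) (A : Finset E) : A × Bool ≃ D.endpointsOf A where
  toFun x := ⟨D.endpoint (x.1, x.2), by simp [endpointsOf]⟩
  invFun p := (⟨(D.endpoint.symm p.1).1, by
    obtain ⟨x, hx, hp⟩ := Finset.mem_map.1 p.2
    rw [← hp]
    simpa using hx⟩, (D.endpoint.symm p.1).2)
  left_inv x := by simp
  right_inv p := by simp

/-- The chord diagram obtained by removing all chords that are not in `A`; the remaining endpoints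
are renumbered in the same order. -/
def restrict (D : ChordDiagram E) (A : Finset E) : ChordDiagram A where
  endpoint := (D.endpointEquiv A).trans
    ((D.endpointsOf A).orderIsoOfFin (D.card_endpointsOf A)).symm.toEquiv

/-- The matrix `M_A`: the adjacency matrix over `ZMod 2` of the intersection graph of the
subdiagram on the chords in `A`. -/
def adjacencyMatrix (D : ChordDiagram E) (A : Finset E) : Matrix A A (ZMod 2) :=
  (D.restrict A).intersectionGraph.adjMatrix (ZMod 2)

/-- The corners of the ribbons obtained by thickening the chords, as points of the circle.
`(p, false)` and `(p, true)` lie just before and just after the endpoint `p`. The thickened chords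
are not twisted: each free side of a ribbon joins the point just after one endpoint to the point
just before the other one. -/
def cornerEquiv (D : ChordDiagram E) : RibbonCorner E ≃ Fin (2 * Fintype.card E) × Bool where
  toFun c := (D.endpoint (c.1, c.2.1), xor c.2.1 c.2.2)
  invFun q := ((D.endpoint.symm q.1).1, (D.endpoint.symm q.1).2,
    xor (D.endpoint.symm q.1).2 q.2)
  left_inv c := by simp
  right_inv q := by simp

/-- For `m` points on a circle, the position just after a point and the position just before the
next point are the two ends of the same segment of the circle. -/
def circleNext (m : ℕ) : Equiv.Perm (Fin m × Bool) where
  toFun q := if q.2 then (finRotate m q.1, false) else ((finRotate m).symm q.1, true)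
  invFun q := if q.2 then (finRotate m q.1, false) else ((finRotate m).symm q.1, true)
  left_inv q := by
    rcases q with ⟨p, _ | _⟩ <;> simp [-finRotate_apply, -finRotate_symm_apply]
  right_inv q := by
    rcases q with ⟨p, _ | _⟩ <;> simp [-finRotate_apply, -finRotate_symm_apply]

/-- The ribbon graph associated to a chord diagram: attach a disc to the circle and thicken the
chords. If there is no chord, it is a single vertex-disc without ribbons. -/
def ribbonGraph (D : ChordDiagram E) : RibbonGraph E where
  next := (D.cornerEquiv.trans (circleNext _)).trans D.cornerEquiv.symm
  next_next c := by
    have h : ∀ q, circleNext (2 * Fintype.card E) (circleNext _ q) = q :=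
      (circleNext _).left_inv
    simp [h]
  next_ne c hc := by
    have h : ∀ q, circleNext (2 * Fintype.card E) q ≠ q := fun q => by
      rcases q with ⟨p, _ | _⟩ <;> simp [circleNext]
    apply h (D.cornerEquiv c)
    have := congrArg D.cornerEquiv hc
    simpa using this
  isolated := if Fintype.card E = 0 then 1 else 0

end ChordDiagram

/-!
Write `f(A)` for the number of boundary components of the spanning surface `F_A`. The vertices of
the partial dual `G^A` correspond to the boundary components of `F_A`, its faces to those of
`F_{Aᶜ}`, and it is connected, so its Euler genus is `2 + |E| - f(A) - f(Aᶜ)`. The theorem thus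
follows, term by term, from the formula `f(A) + rank M_A = |A| + 1`
(`ChordDiagram.numSpanningBoundary_add_rank`).

To prove this formula, the functions with values in `ZMod 2` that are constant on each boundary
component of `F_A` are counted in two ways. On the one hand there are `2 ^ f(A)` of them
(`RibbonGraph.card_invariantFunctions`). On the other hand, such a function is constant on each
segment of the circle, so it is determined by its value at the base point and by its jumps at the
endpoints of chords. There is no jump at the endpoints of a chord outside `A`. For a chord `e` in
`A`, the two free sides of its ribbon impose two conditions: the jumps at both endpoints agree, with
a common value `x e`, and the jumps at the points between the endpoints add up to zero. A chord
contributes to the latter sum exactly if it intersects `e`, since otherwise it has none or two of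
its endpoints there. So the condition is that `M_A x = 0`. Conversely, the jumps coming from a
vector `x` add up to zero along the whole circle, hence they are the jumps of a function. So there
are `2 * 2 ^ (|A| - rank M_A)` functions (`ChordDiagram.boundaryFunctionsEquiv`).
-/

/-! ### Counting orbits by invariant functions -/

namespace RibbonGraph

section Orbits

variable {X : Type*}

/-- The functions on `X` with values in `ZMod 2` that are invariant under the permutations
in `S`. -/
def invariantFunctions (S : Set (Equiv.Perm X)) : Set (X → ZMod 2) :=
  {φ | ∀ g ∈ S, ∀ x, φ (g x) = φ x}

theorem eq_of_mem_closure {S : Set (Equiv.Perm X)} {φ : X → ZMod 2}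
    (hφ : φ ∈ invariantFunctions S) {g : Equiv.Perm X} (hg : g ∈ Subgroup.closure S) :
    ∀ x, φ (g x) = φ x := by
  induction hg using Subgroup.closure_induction with
  | mem g hg => exact hφ g hg
  | one => intro x; rfl
  | mul g h _ _ hg hh => intro x; rw [Equiv.Perm.mul_apply, hg, hh]
  | inv g _ hg => intro x; rw [← hg, ← Equiv.Perm.mul_apply, mul_inv_cancel, Equiv.Perm.one_apply]

/-- An invariant function is the same thing as a function on the set of orbits. -/
def invariantFunctionsEquiv (S : Set (Equiv.Perm X)) :
    invariantFunctions S ≃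
      (MulAction.orbitRel.Quotient (Subgroup.closure S) X → ZMod 2) where
  toFun φ := Quotient.lift φ.1 (by
    intro x y h
    obtain ⟨g, rfl⟩ := MulAction.orbitRel_apply.1 h
    exact eq_of_mem_closure φ.2 g.2 y)
  invFun ψ := ⟨fun x => ψ (Quotient.mk _ x), fun g hg x => congrArg ψ (Quotient.sound
    (MulAction.orbitRel_apply.2 ⟨⟨g, Subgroup.subset_closure hg⟩, rfl⟩))⟩
  left_inv φ := rfl
  right_inv ψ := by
    funext q
    induction q using Quotient.inductionOn
    rfl

variable [Finite X]

theorem card_invariantFunctions (S : Set (Equiv.Perm X)) :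
    Nat.card (invariantFunctions S) = 2 ^ numOrbits S := by
  rw [Nat.card_congr (invariantFunctionsEquiv S), Nat.card_fun, Nat.card_zmod]
  rfl

theorem numOrbits_le_of_invariantFunctions_subset {S T : Set (Equiv.Perm X)}
    (h : invariantFunctions T ⊆ invariantFunctions S) : numOrbits T ≤ numOrbits S := by
  have := Nat.card_mono (Set.toFinite _) h
  rw [card_invariantFunctions, card_invariantFunctions] at this
  exact (Nat.pow_le_pow_iff_right one_lt_two).1 this

theorem numOrbits_pos [Nonempty X] (S : Set (Equiv.Perm X)) : 0 < numOrbits S := by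
  have : Nonempty (MulAction.orbitRel.Quotient (Subgroup.closure S) X) :=
    ‹Nonempty X›.map (Quotient.mk _)
  exact Nat.card_pos

end Orbits

/-! ### Partial duals and spanning surfaces -/

section PartialDual

variable {E : Type*} [DecidableEq E]

theorem exchange_conj_spanningStep (A : Finset E) :
    exchange A * spanningStep A * (exchange A)⁻¹ = across E := by
  change exchange A * _ * exchange A = _
  ext1 c
  by_cases h : c.1 ∈ A <;> simp [exchange, spanningStep, along, across, h]

theorem exchange_conj_spanningStep_compl [Fintype E] (A : Finset E) :
    exchange A * spanningStep Aᶜ * (exchange A)⁻¹ = along E := by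
  change exchange A * _ * exchange A = _
  ext1 c
  by_cases h : c.1 ∈ A <;> simp [exchange, spanningStep, along, across, h]

/-- The face-discs of `G^A` correspond to the boundary components of the complementary
spanning surface. -/
theorem numFaces_partialDual [Fintype E] (G : RibbonGraph E) (A : Finset E) :
    (G.partialDual A).numFaces = G.numSpanningBoundary Aᶜ := by
  unfold numFaces numSpanningBoundary
  rw [← numOrbits_conj (exchange A) {G.next, spanningStep Aᶜ}, Set.image_pair,
    exchange_conj_spanningStep_compl]
  rfl

theorem numSpanningBoundary_empty (G : RibbonGraph E) :
    G.numSpanningBoundary ∅ = G.numVertices := by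
  have h : spanningStep (∅ : Finset E) = across E := by
    ext1 c
    simp [spanningStep]
  rw [numSpanningBoundary, h, numVertices]

/-- A component of `G^A` contains, with a vertex-disc of `G`, all segments on its boundary. -/
theorem numComponents_partialDual_le [Fintype E] (G : RibbonGraph E) (A : Finset E) :
    (G.partialDual A).numComponents ≤ G.numVertices := by
  have h : (fun g => exchange A * g * (exchange A)⁻¹) ''
      {G.next, spanningStep A, spanningStep Aᶜ} =
      {(G.partialDual A).next, across E, along E} := by
    rw [Set.image_insert_eq, Set.image_pair, exchange_conj_spanningStep,
      exchange_conj_spanningStep_compl]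
    rfl
  unfold numComponents numVertices
  rw [← h, numOrbits_conj]
  refine Nat.add_le_add_right (numOrbits_le_of_invariantFunctions_subset ?_) _
  rintro φ hφ g (rfl | rfl)
  · exact hφ _ (by simp)
  · intro c
    -- Outside `A` the step of `F_A` moves across the ribbon, inside `A` the step of `F_{Aᶜ}` does.
    by_cases hc : c.1 ∈ A
    · have := hφ (spanningStep Aᶜ) (by simp) c
      simpa [spanningStep, hc] using this
    · have := hφ (spanningStep A) (by simp) c
      simpa [spanningStep, hc] using this

end PartialDual

end RibbonGraph

/-! ### Functions on the segments of a circle -/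

namespace ChordDiagram

section Circle

variable {m : ℕ}

/-- The sum of the values of `δ` at the points numbered `0, …, k - 1`. -/
def partialSum (δ : Fin m → ZMod 2) (k : ℕ) : ZMod 2 :=
  ∑ p with p.val < k, δ p

theorem partialSum_zero (δ : Fin m → ZMod 2) : partialSum δ 0 = 0 := by
  simp [partialSum]

theorem partialSum_succ (δ : Fin m → ZMod 2) (p : Fin m) :
    partialSum δ (p + 1) = partialSum δ p + δ p := by
  have h : Finset.univ.filter (fun q : Fin m => q.val < p + 1) =
      insert p (Finset.univ.filter fun q : Fin m => q.val < p) := by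
    ext q
    simp [Fin.ext_iff]
    omega
  rw [partialSum, h, Finset.sum_insert (by simp), add_comm]
  rfl

theorem partialSum_top (δ : Fin m → ZMod 2) : partialSum δ m = ∑ p, δ p := by
  simp [partialSum]

/-- The function on the sides of the `m` points whose value just before the point `0` is `c`,
which jumps by `δ p` at the point `p`, and which is constant between consecutive points. -/
def potential (c : ZMod 2) (δ : Fin m → ZMod 2) (q : Fin m × Bool) : ZMod 2 :=
  c + partialSum δ (q.1 + q.2.toNat)

/-- The jumps of a function on the two sides of each point. -/
def jump (φ : Fin m × Bool → ZMod 2) (p : Fin m) : ZMod 2 :=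
  φ (p, true) - φ (p, false)

theorem potential_true (c : ZMod 2) (δ : Fin m → ZMod 2) (p : Fin m) :
    potential c δ (p, true) = potential c δ (p, false) + δ p := by
  simp [potential, partialSum_succ, add_assoc]

theorem jump_potential (c : ZMod 2) (δ : Fin m → ZMod 2) : jump (potential c δ) = δ := by
  funext p
  simp [jump, potential_true]

theorem potential_circleNext (c : ZMod 2) {δ : Fin m → ZMod 2} (h : ∑ p, δ p = 0)
    (q : Fin m × Bool) : potential c δ (circleNext m q) = potential c δ q := by
  have key : ∀ p : Fin m, potential c δ (finRotate m p, false) = potential c δ (p, true) := by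
    intro p
    obtain _ | m := m
    · exact p.elim0
    by_cases hp : p = Fin.last m
    · subst hp
      have := partialSum_top δ
      simp [potential, this, h, partialSum_zero]
    · have := coe_finRotate_of_ne_last hp
      simp [potential, this, -finRotate_apply]
  obtain ⟨p, _ | _⟩ := q
  · have := key ((finRotate m).symm p)
    rw [Equiv.apply_symm_apply] at this
    exact this.symm
  · exact key p

/-- A function that is constant on the segments of the circle is determined by its value at the
base point and by its jumps. -/
theorem eq_potential [NeZero m] {φ : Fin m × Bool → ZMod 2}
    (h : ∀ q, φ (circleNext m q) = φ q) : φ = potential (φ (0, false)) (jump φ) := by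
  have key : ∀ k (hk : k < m), φ (⟨k, hk⟩, false) =
      potential (φ (0, false)) (jump φ) (⟨k, hk⟩, false) := by
    intro k
    induction k with
    | zero =>
      intro hk
      simp [potential, partialSum_zero]
    | succ k ih =>
      intro hk
      have h1 := h (⟨k, by omega⟩, true)
      have hrot : finRotate m ⟨k, by omega⟩ = ⟨k + 1, hk⟩ := by
        obtain _ | m := m
        · omega
        exact finRotate_of_lt (by omega)
      have h2 : φ (⟨k + 1, hk⟩, false) = φ (⟨k, by omega⟩, true) := by
        rw [← h1, ← hrot]
        rfl
      have h3 := potential_true (φ (0, false)) (jump φ) ⟨k, by omega⟩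
      rw [← ih] at h3
      simp only [jump, add_sub_cancel] at h3
      rw [h2, ← h3]
      simp [potential]
  funext ⟨p, b⟩
  obtain _ | _ := b
  · exact key p p.2
  · rw [potential_true, ← key p p.2]
    simp [jump]

end Circle

/-! ### The intersection matrix -/

variable {E : Type*} [Fintype E]

theorem restrict_first [DecidableEq E] (D : ChordDiagram E) (A : Finset E) (e : A) :
    (D.restrict A).first e = ((D.endpointsOf A).orderIsoOfFin (D.card_endpointsOf A)).symm
      (min (D.endpointEquiv A (e, false)) (D.endpointEquiv A (e, true))) :=
  ((OrderIso.monotone _).map_min).symm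

theorem restrict_second [DecidableEq E] (D : ChordDiagram E) (A : Finset E) (e : A) :
    (D.restrict A).second e = ((D.endpointsOf A).orderIsoOfFin (D.card_endpointsOf A)).symm
      (max (D.endpointEquiv A (e, false)) (D.endpointEquiv A (e, true))) :=
  ((OrderIso.monotone _).map_max).symm

/-- Chords intersect in a subdiagram if and only if they intersect in the whole diagram. -/
theorem restrict_adj [DecidableEq E] (D : ChordDiagram E) (A : Finset E) (e f : A) :
    (D.restrict A).intersectionGraph.Adj e f ↔ D.intersectionGraph.Adj e f := by
  have hmin : ∀ e : A, ((min (D.endpointEquiv A (e, false)) (D.endpointEquiv A (e, true)) :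
      D.endpointsOf A) : Fin (2 * Fintype.card E)) = D.first e := fun e =>
    (Subtype.mono_coe _).map_min
  have hmax : ∀ e : A, ((max (D.endpointEquiv A (e, false)) (D.endpointEquiv A (e, true)) :
      D.endpointsOf A) : Fin (2 * Fintype.card E)) = D.second e := fun e =>
    (Subtype.mono_coe _).map_max
  simp only [intersectionGraph, restrict_first, restrict_second, OrderIso.lt_iff_lt,
    ← Subtype.coe_lt_coe, hmin, hmax]

/-- The function on the endpoints that takes the value `x e` at both endpoints of `e`. -/
def endpointValue (D : ChordDiagram E) (x : E → ZMod 2) (p : Fin (2 * Fintype.card E)) : ZMod 2 :=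
  x (D.endpoint.symm p).1

theorem sum_mul_endpointValue (D : ChordDiagram E) (x : E → ZMod 2)
    (w : Fin (2 * Fintype.card E) → ZMod 2) :
    ∑ p, w p * D.endpointValue x p =
      ∑ e, (w (D.endpoint (e, false)) + w (D.endpoint (e, true))) * x e := by
  rw [← Equiv.sum_comp D.endpoint, Fintype.sum_prod_type]
  refine Finset.sum_congr rfl fun e _ => ?_
  simp [endpointValue]
  ring

theorem sum_endpointValue (D : ChordDiagram E) (x : E → ZMod 2) :
    ∑ p, D.endpointValue x p = 0 := by
  have := D.sum_mul_endpointValue x fun _ => 1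
  simpa [show (1 + 1 : ZMod 2) = 0 from rfl] using this

theorem first_lt_second (D : ChordDiagram E) (e : E) : D.first e < D.second e := by
  rw [first, second, min_lt_max]
  simp

theorem endpoint_mem_chord (D : ChordDiagram E) (e : E) :
    (D.endpoint (e, false) = D.first e ∧ D.endpoint (e, true) = D.second e) ∨
      (D.endpoint (e, false) = D.second e ∧ D.endpoint (e, true) = D.first e) := by
  unfold first second
  rcases le_total (D.endpoint (e, false)) (D.endpoint (e, true)) with h | h
  · left; simp [h]
  · right; simp [h]

/-- Between the endpoints of `e` lie one endpoint of each chord that intersects `e`, and none or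
two endpoints of each other chord. -/
theorem indicator_between (D : ChordDiagram E) (e f : E) :
    (if D.first e < D.endpoint (f, false) ∧ D.endpoint (f, false) < D.second e
        then (1 : ZMod 2) else 0) +
      (if D.first e < D.endpoint (f, true) ∧ D.endpoint (f, true) < D.second e
        then (1 : ZMod 2) else 0) =
      if D.intersectionGraph.Adj e f then 1 else 0 := by
  have hadj : D.intersectionGraph.Adj e f ↔
    ((D.first e < D.first f ∧ D.first f < D.second e ∧ D.second e < D.second f) ∨
    (D.first f < D.first e ∧ D.first e < D.second f ∧ D.second f < D.second e)) := Iff.rfl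
  have h2 : (1 + 1 : ZMod 2) = 0 := rfl
  have hf := D.first_lt_second f
  have he := D.first_lt_second e
  have hne : e ≠ f → D.first e ≠ D.first f ∧ D.first e ≠ D.second f ∧
      D.second e ≠ D.first f ∧ D.second e ≠ D.second f := by
    intro hef
    rcases D.endpoint_mem_chord e with ⟨h1, h2⟩ | ⟨h1, h2⟩ <;>
    rcases D.endpoint_mem_chord f with ⟨h3, h4⟩ | ⟨h3, h4⟩ <;>
    simp [← h1, ← h2, ← h3, ← h4, hef]
  simp only [hadj]
  by_cases hef : e = f
  · subst hef
    rcases D.endpoint_mem_chord e with ⟨h3, h4⟩ | ⟨h3, h4⟩ <;> simp [h3, h4]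
  · obtain ⟨n1, n2, n3, n4⟩ := hne hef
    have key : (if D.first e < D.first f ∧ D.first f < D.second e then (1 : ZMod 2) else 0) +
        (if D.first e < D.second f ∧ D.second f < D.second e then (1 : ZMod 2) else 0) =
        if (D.first e < D.first f ∧ D.first f < D.second e ∧ D.second e < D.second f) ∨
          (D.first f < D.first e ∧ D.first e < D.second f ∧ D.second f < D.second e)
          then 1 else 0 := by
      split_ifs <;> first | rfl | (exfalso; omega)
    rcases D.endpoint_mem_chord f with ⟨h3, h4⟩ | ⟨h3, h4⟩
    · rw [h3, h4, key]
    · rw [h3, h4, add_comm, key]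

/-- The values of `x` at the endpoints strictly between those of `e` add up to the entry of the
vector `M x` at `e`, where `M` is the adjacency matrix of the whole intersection graph. -/
theorem partialSum_second (D : ChordDiagram E) (x : E → ZMod 2) (e : E) :
    partialSum (D.endpointValue x) (D.second e) =
      partialSum (D.endpointValue x) (D.first e + 1) +
        ∑ f, (if D.intersectionGraph.Adj e f then 1 else 0) * x f := by
  have h := D.sum_mul_endpointValue x
    fun p => if D.first e < p ∧ p < D.second e then 1 else 0
  simp only [D.indicator_between e] at h
  rw [← h, partialSum, partialSum, Finset.sum_filter, Finset.sum_filter, ← Finset.sum_add_distrib]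
  have := D.first_lt_second e
  refine Finset.sum_congr rfl fun p _ => ?_
  simp only [Fin.lt_def] at *
  split_ifs <;> first | (exfalso; omega) | simp

/-! ### Boundary components and the corank -/

variable [DecidableEq E]

theorem adjacencyMatrix_mulVec (D : ChordDiagram E) (A : Finset E) (x : A → ZMod 2) (e : A) :
    (D.adjacencyMatrix A).mulVec x e =
      ∑ f, (if D.intersectionGraph.Adj e f then 1 else 0) *
        Function.extend Subtype.val x 0 f := by
  have h : ∑ f, (if D.intersectionGraph.Adj e f then 1 else 0) *
      Function.extend Subtype.val x 0 f = ∑ f ∈ A, (if D.intersectionGraph.Adj e f then 1 else 0) *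
        Function.extend Subtype.val x 0 f := by
    refine (Finset.sum_subset (Finset.subset_univ A) fun f _ hf => ?_).symm
    rw [Function.extend_apply' _ _ _ (by rintro ⟨a, rfl⟩; exact hf a.2)]
    simp
  rw [h, ← Finset.sum_coe_sort A]
  simp only [adjacencyMatrix, Matrix.mulVec, dotProduct, SimpleGraph.adjMatrix_apply, restrict_adj,
    Subtype.val_injective.extend_apply]

/-- The functions on the sides of the endpoints that are constant on the segments of the circle
and on the boundary components of `F_A`. -/
def boundaryFunctions (D : ChordDiagram E) (A : Finset E) :
    Set (Fin (2 * Fintype.card E) × Bool → ZMod 2) :=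
  {φ | (∀ q, φ (circleNext _ q) = φ q) ∧
    (∀ e ∉ A, ∀ b, φ (D.endpoint (e, b), true) = φ (D.endpoint (e, b), false)) ∧
    ∀ e ∈ A, φ (D.endpoint (e, true), false) = φ (D.endpoint (e, false), true) ∧
      φ (D.endpoint (e, true), true) = φ (D.endpoint (e, false), false)}

/-- In terms of corners, `boundaryFunctions` are the functions that are invariant under the two
permutations whose orbits are the boundary components of `F_A`. -/
theorem comp_cornerEquiv_mem (D : ChordDiagram E) (A : Finset E)
    (φ : Fin (2 * Fintype.card E) × Bool → ZMod 2) :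
    φ ∘ D.cornerEquiv ∈
        RibbonGraph.invariantFunctions {D.ribbonGraph.next, RibbonGraph.spanningStep A} ↔
      φ ∈ D.boundaryFunctions A := by
  have h1 : (∀ c, φ (D.cornerEquiv (D.ribbonGraph.next c)) = φ (D.cornerEquiv c)) ↔
      ∀ q, φ (circleNext _ q) = φ q := by
    rw [← D.cornerEquiv.forall_congr_right (q := fun q => φ (circleNext _ q) = φ q)]
    simp [ribbonGraph]
  have h2 : (∀ c, φ (D.cornerEquiv (RibbonGraph.spanningStep A c)) = φ (D.cornerEquiv c)) ↔
      (∀ e ∉ A, ∀ b, φ (D.endpoint (e, b), true) = φ (D.endpoint (e, b), false)) ∧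
      ∀ e ∈ A, φ (D.endpoint (e, true), false) = φ (D.endpoint (e, false), true) ∧
      φ (D.endpoint (e, true), true) = φ (D.endpoint (e, false), false) := by
    simp only [Prod.forall]
    rw [← forall_and]
    refine forall_congr' fun e => ?_
    by_cases he : e ∈ A <;>
      simp [he, RibbonGraph.spanningStep, RibbonGraph.along, RibbonGraph.across, cornerEquiv,
        Bool.forall_bool] <;> grind
  simp only [RibbonGraph.invariantFunctions, boundaryFunctions, Set.mem_ofPred_eq,
    Set.mem_insert_iff, Set.mem_singleton_iff, forall_eq_or_imp, forall_eq, Function.comp_apply,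
    h1, h2]

/-- Let a function on the circle jump by `x e` at both endpoints of each chord `e` in `A`. It takes
equal values at the two ends of a free side of `e` if and only if its jumps strictly between the
endpoints of `e` add up to zero, and by `partialSum_second` this is the row of `M_A x = 0` that
belongs to `e`. -/
theorem potential_mem_boundaryFunctions (D : ChordDiagram E) (A : Finset E) (c : ZMod 2)
    (x : A → ZMod 2) :
    potential c (D.endpointValue (Function.extend Subtype.val x 0)) ∈ D.boundaryFunctions A ↔
      (D.adjacencyMatrix A).mulVec x = 0 := by
  set y := Function.extend Subtype.val x 0 with hy
  have hval : ∀ e b, D.endpointValue y (D.endpoint (e, b)) = y e := fun e b => by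
    simp [endpointValue]
  have hchord : ∀ e, (potential c (D.endpointValue y) (D.endpoint (e, true), false) =
        potential c (D.endpointValue y) (D.endpoint (e, false), true) ∧
      potential c (D.endpointValue y) (D.endpoint (e, true), true) =
        potential c (D.endpointValue y) (D.endpoint (e, false), false)) ↔
      ∑ f, (if D.intersectionGraph.Adj e f then 1 else 0) * y f = 0 := by
    intro e
    have h1 : potential c (D.endpointValue y) (D.second e, false) =
        potential c (D.endpointValue y) (D.first e, true) +
          ∑ f, (if D.intersectionGraph.Adj e f then 1 else 0) * y f := by
      simp [potential, partialSum_second, add_assoc]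
    have h2 := potential_true c (D.endpointValue y) (D.endpoint (e, true))
    have h3 := potential_true c (D.endpointValue y) (D.endpoint (e, false))
    rw [hval] at h2 h3
    generalize ∑ f, (if D.intersectionGraph.Adj e f then 1 else 0) * y f = s at *
    rcases D.endpoint_mem_chord e with ⟨h4, h5⟩ | ⟨h4, h5⟩ <;> rw [h4] at h3 ⊢ <;> rw [h5] at h2 ⊢
    · rw [h2, h1, h3]
      generalize potential c (D.endpointValue y) _ = a
      generalize y e = z
      clear h1
      revert a z s
      decide
    · rw [h3, h1, h2]
      generalize potential c (D.endpointValue y) _ = a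
      generalize y e = z
      clear h1
      revert a z s
      decide
  constructor
  · rintro ⟨-, -, h⟩
    funext e
    rw [adjacencyMatrix_mulVec]
    exact (hchord e).1 (h e e.2)
  · intro h
    refine ⟨potential_circleNext c (D.sum_endpointValue y), fun e he b => ?_, fun e he => ?_⟩
    · rw [potential_true, hval, hy,
        Function.extend_apply' _ _ _ (by rintro ⟨a, rfl⟩; exact he a.2)]
      simp
    · rw [hchord]
      have := congrFun h ⟨e, he⟩
      rwa [adjacencyMatrix_mulVec] at this

/-- A function that is constant on the boundary components of `F_A` jumps by the same amount at both
endpoints of each chord in `A`, and does not jump at the other endpoints. -/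
theorem jump_of_mem_boundaryFunctions (D : ChordDiagram E) {A : Finset E}
    {φ : Fin (2 * Fintype.card E) × Bool → ZMod 2} (hφ : φ ∈ D.boundaryFunctions A) :
    jump φ = D.endpointValue
      (Function.extend Subtype.val (fun e : A => jump φ (D.endpoint (e, false))) 0) := by
  obtain ⟨-, h1, h2⟩ := hφ
  funext p
  obtain ⟨⟨e, b⟩, rfl⟩ := D.endpoint.surjective p
  simp only [endpointValue, Equiv.symm_apply_apply]
  by_cases he : e ∈ A
  · rw [show e = Subtype.val (⟨e, he⟩ : A) from rfl, Subtype.val_injective.extend_apply]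
    obtain _ | _ := b
    · rfl
    · simp only [jump, (h2 e he).1, (h2 e he).2]
      -- In characteristic `2` the sign of a jump does not matter.
      rw [← neg_sub, ZMod.neg_eq_self_mod_two]
  · rw [Function.extend_apply' _ _ _ (by rintro ⟨a, rfl⟩; exact he a.2)]
    simp [jump, h1 e he]

/-- Functions constant on the boundary components of `F_A` correspond to pairs of a value at the
base point and a vector in the kernel of `M_A`. -/
noncomputable def boundaryFunctionsEquiv (D : ChordDiagram E) (A : Finset E)
    [NeZero (2 * Fintype.card E)] :
    D.boundaryFunctions A ≃ ZMod 2 × LinearMap.ker (D.adjacencyMatrix A).mulVecLin where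
  toFun φ := (φ.1 (0, false), ⟨fun e => jump φ.1 (D.endpoint (e, false)), by
    rw [LinearMap.mem_ker, Matrix.mulVecLin_apply,
      ← potential_mem_boundaryFunctions D A (φ.1 (0, false)),
      ← D.jump_of_mem_boundaryFunctions φ.2, ← eq_potential φ.2.1]
    exact φ.2⟩)
  invFun v := ⟨potential v.1 (D.endpointValue (Function.extend Subtype.val v.2.1 0)),
    (potential_mem_boundaryFunctions D A v.1 v.2.1).2 v.2.2⟩
  left_inv φ := Subtype.ext <| by
    change potential (φ.1 (0, false)) (D.endpointValue
      (Function.extend Subtype.val (fun e : A => jump φ.1 (D.endpoint (e, false))) 0)) = φ.1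
    rw [← D.jump_of_mem_boundaryFunctions φ.2, ← eq_potential φ.2.1]
  right_inv v := by
    refine Prod.ext ?_ (Subtype.ext (funext fun e => ?_))
    · simp [potential, partialSum_zero]
    · simp [jump_potential, endpointValue]

/-- The number of boundary components of `F_A` is one more than the corank of `M_A`. -/
theorem numSpanningBoundary_add_rank (D : ChordDiagram E) (A : Finset E) :
    D.ribbonGraph.numSpanningBoundary A + (D.adjacencyMatrix A).rank = A.card + 1 := by
  have hrank := LinearMap.finrank_range_add_finrank_ker (D.adjacencyMatrix A).mulVecLin
  rw [Module.finrank_fintype_fun_eq_card, Fintype.card_coe, ← Matrix.rank] at hrank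
  rcases isEmpty_or_nonempty E with hE | hE
  · have hA : A = ∅ := Finset.eq_empty_of_isEmpty A
    subst hA
    have h0 : RibbonGraph.numOrbits
        {D.ribbonGraph.next, RibbonGraph.spanningStep (∅ : Finset E)} = 0 := by
      unfold RibbonGraph.numOrbits
      have : IsEmpty (RibbonCorner E) := inferInstanceAs (IsEmpty (E × Bool × Bool))
      exact Nat.card_of_isEmpty
    rw [Finset.card_empty] at hrank
    have hi : D.ribbonGraph.isolated = 1 := by simp [ribbonGraph]
    rw [RibbonGraph.numSpanningBoundary, h0, hi, Finset.card_empty]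
    omega
  · have : NeZero (2 * Fintype.card E) := ⟨by simp⟩
    have hcard := RibbonGraph.card_invariantFunctions
      {D.ribbonGraph.next, RibbonGraph.spanningStep A}
    have hequiv : RibbonGraph.invariantFunctions
        {D.ribbonGraph.next, RibbonGraph.spanningStep A} ≃ D.boundaryFunctions A :=
      ((Equiv.arrowCongr D.cornerEquiv (Equiv.refl _)).symm.subtypeEquiv
        fun φ => (D.comp_cornerEquiv_mem A φ).symm).symm
    rw [Nat.card_congr (hequiv.trans (D.boundaryFunctionsEquiv A)), Nat.card_prod, Nat.card_zmod,
      Module.natCard_eq_pow_finrank (K := ZMod 2), Nat.card_zmod, ← pow_succ'] at hcard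
    have := Nat.pow_right_injective le_rfl hcard
    simp only [RibbonGraph.numSpanningBoundary, ribbonGraph, Fintype.card_ne_zero, if_false] at *
    omega

/-- The graph `G` has a single vertex-disc, because that disc is the only boundary component
of `F_∅`; so every partial dual is connected. -/
theorem numComponents_partialDual (D : ChordDiagram E) (A : Finset E) :
    (D.ribbonGraph.partialDual A).numComponents = 1 := by
  have h1 := D.ribbonGraph.numComponents_partialDual_le A
  have h2 := D.numSpanningBoundary_add_rank ∅
  rw [RibbonGraph.numSpanningBoundary_empty, Finset.card_empty] at h2
  refine le_antisymm (by omega) ?_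
  rcases isEmpty_or_nonempty E with hE | hE
  · simp [RibbonGraph.numComponents, RibbonGraph.partialDual, ribbonGraph]
  · exact (RibbonGraph.numOrbits_pos _).trans_le (Nat.le_add_right _ _)

theorem eulerGenus_partialDual (D : ChordDiagram E) (A : Finset E) :
    (D.ribbonGraph.partialDual A).eulerGenus =
      ((D.adjacencyMatrix A).rank + (D.adjacencyMatrix Aᶜ).rank : ℕ) := by
  have h1 := D.numSpanningBoundary_add_rank A
  have h2 := D.numSpanningBoundary_add_rank Aᶜ
  have h3 := A.card_add_card_compl
  rw [RibbonGraph.eulerGenus, D.numComponents_partialDual, RibbonGraph.numVertices_partialDual,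
    RibbonGraph.numFaces_partialDual]
  omega

end ChordDiagram

theorem theorem1 {E : Type*} [Fintype E] [DecidableEq E] (D : ChordDiagram E) :
    D.ribbonGraph.partialDualGenusPolynomial =
      Polynomial.toLaurent (∑ A : Finset E,
        (Polynomial.X : Polynomial ℤ) ^
          ((D.adjacencyMatrix A).rank + (D.adjacencyMatrix Aᶜ).rank)) := by
  rw [RibbonGraph.partialDualGenusPolynomial, map_sum]
  refine Finset.sum_congr rfl fun A _ => ?_
  rw [D.eulerGenus_partialDual, Polynomial.toLaurent_X_pow]
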